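/- For a finite simple graph $\mathcal G=(V,E)$ let $\mathcal M_{\mathcal G}$ be the minimal Sullivan algebra over $\mathbb Q$ $$\mathcal M_{\mathcal G}=\big(\Lambda(x_1,x_2,y_1,y_2,y_3,z)\otimes\Lambda(x_v,z_v\mid v\in V),\,d\big),$$ where $\Lambda$ denotes the free graded commutative algebra, the generators have degrees $|x_1|=8$, $|x_2|=10$, $|y_1|=33$, $|y_2|=35$, $|y_3|=37$, $|z|=119$, $|x_v|=40$, $|z_v|=119$, and the differential $d$ (the derivation of degree $+1$) is given by $$d x_1=d x_2=d x_v=0,\quad d y_1=x_1^3x_2,\quad d y_2=x_1^2x_2^2,\quad d y_3=x_1x_2^3,$$ $$d z=y_1y_2x_1^4x_2^2-y_1y_3x_1^5x_2+y_2y_3x_1^6+x_1^{15}+x_2^{12},\qquad d z_v=x_v^3+\sum_{(v,w)\in E}x_vx_wx_2^4,$$ the last sum running over the neighbours $w$ of $v$. Proposition. Let $\mathcal G_1$ and $\mathcal G_2$ be non-isomorphic finite simple graphs. Then $\mathcal M_{\mathcal G_1}$ and $\mathcal M_{\mathcal G_2}$ are not isomorphic as commutative differential graded algebras over $\mathbb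 Q$, i.e. there is no isomorphism of $\mathbb Q$-algebras $\mathcal M_{\mathcal G_1}\to\mathcal M_{\mathcal G_2}$ that preserves degrees and commutes with the differentials. -/

import Mathlib

universe u v

/-! ### Commutative differential graded algebras over `ℚ` -/

/-- A commutative differential graded algebra over `ℚ`, graded in non-negative degrees, with
differential of degree `+1`. -/
structure CDGA where
  carrier : Type u
  [ring : Ring carrier]
  [algebra : Algebra ℚ carrier]
  /-- `grading n` is the subspace of homogeneous elements of degree `n`. -/
  grading : ℕ → Submodule ℚ carrier
  [gradedAlgebra : GradedAlgebra grading]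
  /-- graded commutativity -/
  graded_comm : ∀ {m n : ℕ} {a b : carrier}, a ∈ grading m → b ∈ grading n →
    a * b = (-1 : ℚ) ^ (m * n) • (b * a)
  /-- the differential -/
  d : carrier →ₗ[ℚ] carrier
  d_mem : ∀ {n : ℕ} {a : carrier}, a ∈ grading n → d a ∈ grading (n + 1)
  d_d : ∀ a : carrier, d (d a) = 0
  leibniz : ∀ {m : ℕ} {a : carrier} (b : carrier), a ∈ grading m →
    d (a * b) = d a * b + (-1 : ℚ) ^ m • (a * d b)

attribute [instance] CDGA.ring CDGA.algebra CDGA.gradedAlgebra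

/-- An isomorphism of commutative differential graded algebras: an isomorphism of `ℚ`-algebras
that respects the degrees and commutes with the differentials. -/
structure CDGA.Iso (A : CDGA.{u}) (B : CDGA.{v}) where
  toAlgEquiv : A.carrier ≃ₐ[ℚ] B.carrier
  mem_grading_iff : ∀ (n : ℕ) (a : A.carrier), toAlgEquiv a ∈ B.grading n ↔ a ∈ A.grading n
  map_d : ∀ a : A.carrier, toAlgEquiv (A.d a) = B.d (toAlgEquiv a)

/-! ### The free graded commutative algebra -/

section FreeCGA

variable {ι : Type u} (deg : ι → ℕ)

/-- The relations `w w' = (-1)^{|w| |w'|} w' w` between generators. Over `ℚ` they imply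
`w² = 0` for every generator `w` of odd degree. -/
inductive FreeCGA.Rel : FreeAlgebra ℚ ι → FreeAlgebra ℚ ι → Prop
  | comm (i j : ι) : FreeCGA.Rel (FreeAlgebra.ι ℚ i * FreeAlgebra.ι ℚ j)
      ((-1 : ℚ) ^ (deg i * deg j) • (FreeAlgebra.ι ℚ j * FreeAlgebra.ι ℚ i))

/-- The free graded commutative algebra `ΛW` on the graded rational vector space `W` with basis `ι`,
where the basis vector `i` has degree `deg i`: the tensor (free) algebra modulo graded
commutativity of the generators. -/
def FreeCGA : Type u := RingQuot (FreeCGA.Rel deg)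

namespace FreeCGA

noncomputable instance instRing : Ring (FreeCGA deg) :=
  inferInstanceAs (Ring (RingQuot (Rel deg)))

noncomputable instance instAlgebra : Algebra ℚ (FreeCGA deg) :=
  inferInstanceAs (Algebra ℚ (RingQuot (Rel deg)))

/-- The projection from the free algebra. -/
noncomputable def mk : FreeAlgebra ℚ ι →ₐ[ℚ] FreeCGA deg :=
  RingQuot.mkAlgHom ℚ (Rel deg)

/-- The generators. -/
noncomputable def gen (i : ι) : FreeCGA deg :=
  mk deg (FreeAlgebra.ι ℚ i)

/-- The homogeneous elements of degree `n`: the span of the monomials of total degree `n`. -/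
noncomputable def homogeneous (n : ℕ) : Submodule ℚ (FreeCGA deg) :=
  Submodule.span ℚ {a | ∃ l : List ι, (l.map deg).sum = n ∧ a = (l.map (gen deg)).prod}

variable {deg}

theorem gen_mul_gen (i j : ι) :
    gen deg i * gen deg j = (-1 : ℚ) ^ (deg i * deg j) • (gen deg j * gen deg i) := by
  have h : mk deg _ = mk deg _ := RingQuot.mkAlgHom_rel ℚ (Rel.comm (deg := deg) i j)
  simpa [gen] using h

/-- The universal property. -/
noncomputable def lift {B : Type v} [Semiring B] [Algebra ℚ B] (f : ι → B)
    (hf : ∀ i j, f i * f j = (-1 : ℚ) ^ (deg i * deg j) • (f j * f i)) : FreeCGA deg →ₐ[ℚ] B :=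
  RingQuot.liftAlgHom ℚ ⟨FreeAlgebra.lift ℚ f, by
    rintro _ _ ⟨i, j⟩
    simpa using hf i j⟩

@[simp] theorem lift_gen {B : Type v} [Semiring B] [Algebra ℚ B] (f : ι → B)
    (hf : ∀ i j, f i * f j = (-1 : ℚ) ^ (deg i * deg j) • (f j * f i)) (i : ι) :
    lift f hf (gen deg i) = f i := by
  exact (RingQuot.liftAlgHom_mkAlgHom_apply ℚ _ _ _).trans (FreeAlgebra.lift_ι_apply f i)

theorem algHom_ext {B : Type v} [Semiring B] [Algebra ℚ B] {f g : FreeCGA deg →ₐ[ℚ] B}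
    (h : ∀ i, f (gen deg i) = g (gen deg i)) : f = g := by
  refine RingQuot.ringQuot_ext' (s := Rel deg) ℚ f g (FreeAlgebra.hom_ext ?_)
  funext i
  exact h i

theorem prod_mem (l : List ι) :
    (l.map (gen deg)).prod ∈ homogeneous deg (l.map deg).sum :=
  Submodule.subset_span ⟨l, rfl, rfl⟩

theorem gen_mem (i : ι) : gen deg i ∈ homogeneous deg (deg i) := by
  simpa using prod_mem (deg := deg) [i]

instance instGradedMonoid : SetLike.GradedMonoid (homogeneous deg) where
  one_mem := by simpa using prod_mem (deg := deg) []
  mul_mem := by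
    intro m n a b ha hb
    have h := Submodule.mul_mem_mul ha hb
    rw [homogeneous, homogeneous, Submodule.span_mul_span] at h
    refine Submodule.span_mono ?_ h
    rintro _ ⟨_, ⟨l, hl, rfl⟩, _, ⟨l', hl', rfl⟩, rfl⟩
    exact ⟨l ++ l', by simp [hl, hl'], by simp⟩

theorem of_congr {m n : ℕ} (h : m = n) {a b : FreeCGA deg} (ha : a ∈ homogeneous deg m)
    (hb : b ∈ homogeneous deg n) (hab : a = b) :
    DirectSum.of (fun k => homogeneous deg k) m ⟨a, ha⟩ =
      DirectSum.of (fun k => homogeneous deg k) n ⟨b, hb⟩ := by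
  subst h hab
  rfl

/-- The decomposition of an element into its homogeneous components. -/
noncomputable def decomp : FreeCGA deg →ₐ[ℚ] DirectSum ℕ (fun k => homogeneous deg k) :=
  lift (fun i => DirectSum.of (fun k => homogeneous deg k) (deg i) ⟨gen deg i, gen_mem i⟩) (by
    intro i j
    rw [DirectSum.of_mul_of, DirectSum.of_mul_of, ← DirectSum.of_smul]
    exact of_congr (add_comm _ _) _ (Submodule.smul_mem _ _ (SetLike.mul_mem_graded
      (gen_mem j) (gen_mem i))) (gen_mul_gen i j))

theorem decomp_prod (l : List ι) :
    decomp (l.map (gen deg)).prod =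
      DirectSum.of (fun k => homogeneous deg k) (l.map deg).sum ⟨_, prod_mem l⟩ := by
  induction l with
  | nil => exact map_one decomp
  | cons i l ih =>
    have h : decomp ((i :: l).map (gen deg)).prod =
        decomp (gen deg i) * decomp (l.map (gen deg)).prod := by
      rw [List.map_cons, List.prod_cons, map_mul]
    rw [h, ih, decomp, lift_gen, DirectSum.of_mul_of]
    exact of_congr (by simp) _ _ (by simp)

noncomputable instance instGradedAlgebra : GradedAlgebra (homogeneous deg) :=
  GradedAlgebra.ofAlgHom _ decomp
    (algHom_ext fun i => by simp [decomp])
    (by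
      rintro n ⟨a, ha⟩
      induction ha using Submodule.span_induction with
      | mem a h =>
        obtain ⟨l, rfl, rfl⟩ := h
        exact decomp_prod l
      | zero =>
        rw [map_zero]
        exact (map_zero (DirectSum.of (fun k => homogeneous deg k) n)).symm
      | add a b ha hb iha ihb =>
        simp only at iha ihb ⊢
        rw [map_add, iha, ihb, ← map_add]
        rfl
      | smul c a ha iha =>
        simp only at iha ⊢
        rw [map_smul, iha, ← DirectSum.of_smul]
        rfl)

theorem gen_mul_comm (i : ι) {n : ℕ} {b : FreeCGA deg} (hb : b ∈ homogeneous deg n) :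
    gen deg i * b = (-1 : ℚ) ^ (deg i * n) • (b * gen deg i) := by
  induction hb using Submodule.span_induction with
  | mem b h =>
    obtain ⟨l, rfl, rfl⟩ := h
    induction l with
    | nil => simp
    | cons j l ih =>
      simp only [List.map_cons, List.prod_cons, List.sum_cons]
      rw [← mul_assoc, gen_mul_gen, smul_mul_assoc, mul_assoc, ih, mul_smul_comm, smul_smul,
        mul_add, pow_add, mul_assoc]
  | zero => simp
  | add a b _ _ iha ihb => rw [mul_add, iha, ihb, add_mul, smul_add]
  | smul c a _ iha => rw [mul_smul_comm, iha, smul_mul_assoc, smul_comm]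

theorem graded_comm {m n : ℕ} {a b : FreeCGA deg} (ha : a ∈ homogeneous deg m)
    (hb : b ∈ homogeneous deg n) : a * b = (-1 : ℚ) ^ (m * n) • (b * a) := by
  induction ha using Submodule.span_induction with
  | mem a h =>
    obtain ⟨l, rfl, rfl⟩ := h
    induction l with
    | nil => simp
    | cons j l ih =>
      simp only [List.map_cons, List.prod_cons, List.sum_cons]
      rw [mul_assoc, ih, mul_smul_comm, ← mul_assoc, gen_mul_comm j hb, smul_mul_assoc, smul_smul,
        add_mul, pow_add, mul_assoc, mul_comm ((-1 : ℚ) ^ (deg j * n))]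
  | zero => simp
  | add a b _ _ iha ihb => rw [add_mul, iha, ihb, mul_add, smul_add]
  | smul c a _ iha => rw [mul_smul_comm, smul_mul_assoc, iha, smul_comm]

section Derivation

variable (D : ι → FreeCGA deg) (hD : ∀ i, D i ∈ homogeneous deg (deg i + 1))

/-- The algebra map `a ↦ !![(-1)^|a| a, d a; 0, a]`, which encodes the (graded) derivation `d` of
degree `+1` with `d (gen i) = D i`. -/
noncomputable def derivMatrix : FreeCGA deg →ₐ[ℚ] Matrix (Fin 2) (Fin 2) (FreeCGA deg) :=
  lift (fun i => !![(-1 : ℚ) ^ deg i • gen deg i, D i; 0, gen deg i]) (by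
    intro i j
    have h1 := gen_mul_gen (deg := deg) i j
    have h2 := gen_mul_comm (deg := deg) i (hD j)
    have h3 := graded_comm (hD i) (gen_mem j)
    have e1 : (-1 : ℚ) ^ deg i * (-1) ^ (deg i * (deg j + 1)) = (-1) ^ (deg i * deg j) := by
      rw [← pow_add, show deg i + deg i * (deg j + 1) = 2 * deg i + deg i * deg j by ring,
        pow_add, pow_mul]
      simp
    have e2 : (-1 : ℚ) ^ ((deg i + 1) * deg j) = (-1) ^ (deg i * deg j) * (-1) ^ deg j := by
      rw [← pow_add]
      ring_nf
    ext p q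
    fin_cases p <;> fin_cases q
    · simp [Matrix.mul_apply, Fin.sum_univ_two, h1, smul_smul]
      ring_nf
    · simp [Matrix.mul_apply, Fin.sum_univ_two, h2, h3, smul_smul, e1, e2, add_comm]
    · simp [Matrix.mul_apply, Fin.sum_univ_two]
    · simpa [Matrix.mul_apply, Fin.sum_univ_two] using h1)

/-- The derivation `d` of degree `+1` of the free graded commutative algebra with
`d (gen i) = D i` for all `i`. -/
noncomputable def deriv : FreeCGA deg →ₗ[ℚ] FreeCGA deg where
  toFun a := derivMatrix D hD a 0 1
  map_add' a b := by simp
  map_smul' c a := by simp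

@[simp] theorem deriv_gen (i : ι) : deriv D hD (gen deg i) = D i := by
  simp [deriv, derivMatrix]

theorem derivMatrix_prod (l : List ι) :
    derivMatrix D hD (l.map (gen deg)).prod 1 0 = 0 ∧
    derivMatrix D hD (l.map (gen deg)).prod 1 1 = (l.map (gen deg)).prod := by
  induction l with
  | nil => simp
  | cons i l ih =>
    rw [List.map_cons, List.prod_cons, map_mul]
    simp only [Matrix.mul_apply, Fin.sum_univ_two, ih.1, ih.2]
    simp [derivMatrix]

/-- The graded Leibniz rule for multiplication by a generator. -/
theorem deriv_gen_mul (i : ι) (l : List ι) :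
    deriv D hD (gen deg i * (l.map (gen deg)).prod) = D i * (l.map (gen deg)).prod +
      (-1 : ℚ) ^ deg i • (gen deg i * deriv D hD (l.map (gen deg)).prod) := by
  have h := derivMatrix_prod D hD l
  have hg : derivMatrix D hD (gen deg i) =
      !![(-1 : ℚ) ^ deg i • gen deg i, D i; 0, gen deg i] := by simp [derivMatrix]
  simp only [deriv, LinearMap.coe_mk, AddHom.coe_mk, map_mul]
  rw [Matrix.mul_apply, Fin.sum_univ_two, h.2, hg]
  simp [add_comm]

theorem deriv_one : deriv D hD 1 = 0 := by
  simp [deriv]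

theorem span_prod_eq_top :
    Submodule.span ℚ (Set.range fun l : List ι => (l.map (gen deg)).prod) = ⊤ := by
  rw [eq_top_iff, ← (DirectSum.Decomposition.isInternal (homogeneous deg)).submodule_iSup_eq_top,
    iSup_le_iff]
  intro n
  refine Submodule.span_mono ?_
  rintro _ ⟨l, -, rfl⟩
  exact ⟨l, rfl⟩

theorem deriv_mem {n : ℕ} {a : FreeCGA deg} (ha : a ∈ homogeneous deg n) :
    deriv D hD a ∈ homogeneous deg (n + 1) := by
  induction ha using Submodule.span_induction with
  | mem a h =>
    obtain ⟨l, rfl, rfl⟩ := h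
    induction l with
    | nil => simp [deriv_one]
    | cons i l ih =>
      simp only [List.map_cons, List.prod_cons, List.sum_cons]
      rw [deriv_gen_mul]
      refine Submodule.add_mem _ ?_ (Submodule.smul_mem _ _ ?_)
      · have := SetLike.mul_mem_graded (hD i) (prod_mem (deg := deg) l)
        rwa [show deg i + 1 + (l.map deg).sum = deg i + (l.map deg).sum + 1 by ring] at this
      · rw [add_assoc]
        exact SetLike.mul_mem_graded (gen_mem i) ih
  | zero => simp
  | add a b _ _ iha ihb => rw [map_add]; exact Submodule.add_mem _ iha ihb
  | smul c a _ iha => rw [map_smul]; exact Submodule.smul_mem _ _ iha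

theorem deriv_prod_mul (l l' : List ι) :
    deriv D hD ((l.map (gen deg)).prod * (l'.map (gen deg)).prod) =
      deriv D hD (l.map (gen deg)).prod * (l'.map (gen deg)).prod +
      (-1 : ℚ) ^ (l.map deg).sum •
        ((l.map (gen deg)).prod * deriv D hD (l'.map (gen deg)).prod) := by
  induction l with
  | nil => simp [deriv_one]
  | cons i l ih =>
    have h := deriv_gen_mul D hD i (l ++ l')
    simp only [List.map_append, List.prod_append] at h
    simp only [List.map_cons, List.prod_cons, List.sum_cons]
    rw [mul_assoc, h, ih, deriv_gen_mul]
    simp only [mul_add, add_mul, smul_add, mul_smul_comm, smul_mul_assoc, smul_smul, pow_add,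
      mul_assoc, add_assoc]

theorem deriv_mul {m : ℕ} {a : FreeCGA deg} (b : FreeCGA deg) (ha : a ∈ homogeneous deg m) :
    deriv D hD (a * b) = deriv D hD a * b + (-1 : ℚ) ^ m • (a * deriv D hD b) := by
  induction ha using Submodule.span_induction with
  | mem a h =>
    obtain ⟨l, rfl, rfl⟩ := h
    have hb : b ∈ Submodule.span ℚ (Set.range fun l : List ι => (l.map (gen deg)).prod) := by
      rw [span_prod_eq_top]
      trivial
    induction hb using Submodule.span_induction with
    | mem b h =>
      obtain ⟨l', rfl⟩ := h
      exact deriv_prod_mul D hD l l'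
    | zero => simp
    | add b c _ _ ihb ihc =>
      simp only [mul_add, map_add, ihb, ihc, smul_add]
      abel
    | smul c b _ ihb =>
      simp only [mul_smul_comm, map_smul, ihb, smul_add]
      rw [smul_comm c]
  | zero => simp
  | add a c _ _ iha ihc =>
    simp only [add_mul, map_add, iha, ihc, smul_add]
    abel
  | smul c a _ iha =>
    simp only [smul_mul_assoc, map_smul, iha, smul_add]
    rw [smul_comm c]

theorem deriv_deriv (hDD : ∀ i, deriv D hD (D i) = 0) (a : FreeCGA deg) :
    deriv D hD (deriv D hD a) = 0 := by
  have ha : a ∈ Submodule.span ℚ (Set.range fun l : List ι => (l.map (gen deg)).prod) := by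
    rw [span_prod_eq_top]
    trivial
  induction ha using Submodule.span_induction with
  | mem a h =>
    obtain ⟨l, rfl⟩ := h
    simp only
    induction l with
    | nil => simp [deriv_one]
    | cons i l ih =>
      rw [List.map_cons, List.prod_cons, deriv_gen_mul, map_add, map_smul,
        deriv_mul D hD _ (hD i), deriv_mul D hD _ (gen_mem i), hDD, ih, deriv_gen]
      simp only [smul_zero, add_zero, zero_mul, zero_add, mul_zero, pow_succ]
      module
  | zero => simp
  | add a b _ _ iha ihb => simp [iha, ihb]
  | smul c a _ iha => simp [iha]

end Derivation

/-- The commutative differential graded algebra `(ΛW, d)`, where `d` is the derivation with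
`d (gen i) = D i`; it is required that `D i` is homogeneous of degree `deg i + 1` and that
`d ∘ d = 0` on the generators. -/
noncomputable def toCDGA (D : ι → FreeCGA deg) (hD : ∀ i, D i ∈ homogeneous deg (deg i + 1))
    (hDD : ∀ i, deriv D hD (D i) = 0) : CDGA.{u} where
  carrier := FreeCGA deg
  grading := homogeneous deg
  graded_comm := graded_comm
  d := deriv D hD
  d_mem := deriv_mem D hD
  d_d := deriv_deriv D hD hDD
  leibniz := deriv_mul D hD

end FreeCGA

end FreeCGA

/-! ### The Sullivan algebra of a graph -/

/-- The generators of the Sullivan algebra of a graph with vertex set `V`. -/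
inductive GraphGen (V : Type u) : Type u
  | x₁ | x₂ | y₁ | y₂ | y₃ | z
  | xv (v : V)
  | zv (v : V)

namespace GraphGen

/-- The degrees of the generators. -/
def degree {V : Type u} : GraphGen V → ℕ
  | x₁ => 8
  | x₂ => 10
  | y₁ => 33
  | y₂ => 35
  | y₃ => 37
  | z => 119
  | xv _ => 40
  | zv _ => 119

end GraphGen

namespace SimpleGraph

open GraphGen

variable {V : Type u} [Fintype V] (G : SimpleGraph V)

open Classical in
/-- The values of the differential on the generators. -/
noncomputable def sullivanDiff : GraphGen V → FreeCGA (GraphGen.degree (V := V)) :=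
  let g := FreeCGA.gen (GraphGen.degree (V := V))
  fun
  | x₁ => 0
  | x₂ => 0
  | y₁ => g x₁ ^ 3 * g x₂
  | y₂ => g x₁ ^ 2 * g x₂ ^ 2
  | y₃ => g x₁ * g x₂ ^ 3
  | z => g y₁ * g y₂ * g x₁ ^ 4 * g x₂ ^ 2 - g y₁ * g y₃ * g x₁ ^ 5 * g x₂
      + g y₂ * g y₃ * g x₁ ^ 6 + g x₁ ^ 15 + g x₂ ^ 12
  | xv _ => 0
  | zv v => g (xv v) ^ 3 + ∑ w : V with G.Adj v w, g (xv v) * g (xv w) * g x₂ ^ 4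

theorem sullivanDiff_mem (i : GraphGen V) :
    G.sullivanDiff i ∈ FreeCGA.homogeneous GraphGen.degree (GraphGen.degree i + 1) := by
  have hp : ∀ (i : GraphGen V) (n k : ℕ), n * GraphGen.degree i = k →
      FreeCGA.gen _ i ^ n ∈ FreeCGA.homogeneous GraphGen.degree k := by
    rintro i n _ rfl
    exact SetLike.pow_mem_graded n (FreeCGA.gen_mem i)
  have hg : ∀ (i : GraphGen V) (k : ℕ), GraphGen.degree i = k →
      FreeCGA.gen _ i ∈ FreeCGA.homogeneous GraphGen.degree k := by
    rintro i _ rfl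
    exact FreeCGA.gen_mem i
  have hm : ∀ (m n : ℕ) {k : ℕ} {a b : FreeCGA (GraphGen.degree (V := V))},
      a ∈ FreeCGA.homogeneous _ m → b ∈ FreeCGA.homogeneous _ n → m + n = k →
      a * b ∈ FreeCGA.homogeneous _ k := by
    rintro m n _ a b ha hb rfl
    exact SetLike.mul_mem_graded ha hb
  cases i with
  | x₁ => exact Submodule.zero_mem _
  | x₂ => exact Submodule.zero_mem _
  | xv v => exact Submodule.zero_mem _
  | y₁ => exact hm 24 10 (hp _ _ _ rfl) (hg _ _ rfl) rfl
  | y₂ => exact hm 16 20 (hp _ _ _ rfl) (hp _ _ _ rfl) rfl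
  | y₃ => exact hm 8 30 (hg _ _ rfl) (hp _ _ _ rfl) rfl
  | z =>
    rw [show GraphGen.degree (z : GraphGen V) + 1 = 120 from rfl]
    simp only [sullivanDiff]
    refine Submodule.add_mem _ (Submodule.add_mem _ (Submodule.add_mem _ (Submodule.sub_mem _
      ?_ ?_) ?_) (hp _ _ _ rfl)) (hp _ _ _ rfl)
    · exact hm 100 20 (hm 68 32 (hm 33 35 (hg _ _ rfl) (hg _ _ rfl) rfl) (hp _ _ _ rfl) rfl)
        (hp _ _ _ rfl) rfl
    · exact hm 110 10 (hm 70 40 (hm 33 37 (hg _ _ rfl) (hg _ _ rfl) rfl) (hp _ _ _ rfl) rfl)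
        (hg _ _ rfl) rfl
    · exact hm 72 48 (hm 35 37 (hg _ _ rfl) (hg _ _ rfl) rfl) (hp _ _ _ rfl) rfl
  | zv v =>
    rw [show GraphGen.degree (zv v : GraphGen V) + 1 = 120 from rfl]
    simp only [sullivanDiff]
    refine Submodule.add_mem _ (hp _ _ _ rfl) (Submodule.sum_mem _ fun w _ => ?_)
    exact hm 80 40 (hm 40 40 (hg _ _ rfl) (hg _ _ rfl) rfl) (hp _ _ _ rfl) rfl

theorem deriv_sullivanDiff (i : GraphGen V) :
    FreeCGA.deriv G.sullivanDiff G.sullivanDiff_mem (G.sullivanDiff i) = 0 := by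
  set δ := FreeCGA.deriv G.sullivanDiff G.sullivanDiff_mem with hδ
  have hg := FreeCGA.gen_mem (deg := GraphGen.degree (V := V))
  have hd : ∀ i, δ (FreeCGA.gen _ i) = G.sullivanDiff i := FreeCGA.deriv_gen _ _
  have hm : ∀ (i : GraphGen V) (b : FreeCGA (GraphGen.degree (V := V))),
      δ (FreeCGA.gen _ i * b) = G.sullivanDiff i * b +
        (-1 : ℚ) ^ GraphGen.degree i • (FreeCGA.gen _ i * δ b) := by
    intro i b
    rw [← hd]
    exact FreeCGA.deriv_mul _ _ b (hg i)
  have h1 : δ 1 = 0 := FreeCGA.deriv_one _ _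
  have hx1 : ∀ b, δ (FreeCGA.gen _ x₁ * b) = FreeCGA.gen _ x₁ * δ b := by
    intro b
    rw [hm]
    simp [sullivanDiff, GraphGen.degree, Even.neg_one_pow (by decide : Even 8)]
  have hx2 : ∀ b, δ (FreeCGA.gen _ x₂ * b) = FreeCGA.gen _ x₂ * δ b := by
    intro b
    rw [hm]
    simp [sullivanDiff, GraphGen.degree, Even.neg_one_pow (by decide : Even 10)]
  have hxv : ∀ v b, δ (FreeCGA.gen _ (xv v) * b) = FreeCGA.gen _ (xv v) * δ b := by
    intro v b
    rw [hm]
    simp [sullivanDiff, GraphGen.degree, Even.neg_one_pow (by decide : Even 40)]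
  have hx1p : ∀ n b, δ (FreeCGA.gen _ x₁ ^ n * b) = FreeCGA.gen _ x₁ ^ n * δ b := by
    intro n b
    induction n with
    | zero => simp
    | succ n ih => rw [pow_succ', mul_assoc, hx1, ih, mul_assoc]
  have hx2p : ∀ n b, δ (FreeCGA.gen _ x₂ ^ n * b) = FreeCGA.gen _ x₂ ^ n * δ b := by
    intro n b
    induction n with
    | zero => simp
    | succ n ih => rw [pow_succ', mul_assoc, hx2, ih, mul_assoc]
  have hxvp : ∀ v n b, δ (FreeCGA.gen _ (xv v) ^ n * b) = FreeCGA.gen _ (xv v) ^ n * δ b := by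
    intro v n b
    induction n with
    | zero => simp
    | succ n ih => rw [pow_succ', mul_assoc, hxv, ih, mul_assoc]
  have k1 : ∀ n, δ (FreeCGA.gen _ x₁ ^ n) = 0 := fun n => by simpa [h1] using hx1p n 1
  have k2 : ∀ n, δ (FreeCGA.gen _ x₂ ^ n) = 0 := fun n => by simpa [h1] using hx2p n 1
  have kv : ∀ v n, δ (FreeCGA.gen _ (xv v) ^ n) = 0 := fun v n => by
    simpa [h1] using hxvp v n 1
  have kx2 : δ (FreeCGA.gen _ x₂) = 0 := by simpa using k2 1
  cases i with
  | x₁ => exact map_zero _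
  | x₂ => exact map_zero _
  | xv v => exact map_zero _
  | y₁ => simp only [sullivanDiff, hx1p, kx2, mul_zero]
  | y₂ => simp only [sullivanDiff, hx1p, k2, mul_zero]
  | y₃ => simp only [sullivanDiff, hx1, k2, mul_zero]
  | zv v =>
    simp only [sullivanDiff, map_add, map_sum, mul_assoc, hxv, kv, k2, mul_zero,
      Finset.sum_const_zero, add_zero]
  | z =>
    have hodd : ∀ {i : GraphGen V}, Odd (GraphGen.degree i) → ∀ b,
        δ (FreeCGA.gen _ i * b) = G.sullivanDiff i * b - FreeCGA.gen _ i * δ b := by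
      intro i hi b
      rw [hm, hi.neg_one_pow, neg_smul, one_smul, sub_eq_add_neg]
    have o1 := hodd (i := y₁) (by simp only [GraphGen.degree]; decide)
    have o2 := hodd (i := y₂) (by simp only [GraphGen.degree]; decide)
    have o3 := hodd (i := y₃) (by simp only [GraphGen.degree]; decide)
    have hc : ∀ {i j : GraphGen V}, Even (GraphGen.degree i) →
        FreeCGA.gen GraphGen.degree i * FreeCGA.gen GraphGen.degree j =
          FreeCGA.gen GraphGen.degree j * FreeCGA.gen GraphGen.degree i := by
      intro i j hi
      rw [FreeCGA.gen_mul_gen, (hi.mul_right _).neg_one_pow, one_smul]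
    have c : ∀ {i j : GraphGen V}, Even (GraphGen.degree i) → ∀ b,
        FreeCGA.gen GraphGen.degree i * (FreeCGA.gen GraphGen.degree j * b) =
          FreeCGA.gen GraphGen.degree j * (FreeCGA.gen GraphGen.degree i * b) := by
      intro i j hi b
      rw [← mul_assoc, hc hi, mul_assoc]
    have e1 : Even (GraphGen.degree (x₁ : GraphGen V)) := by simp only [GraphGen.degree]; decide
    have e2 : Even (GraphGen.degree (x₂ : GraphGen V)) := by simp only [GraphGen.degree]; decide
    simp only [sullivanDiff, map_add, map_sub, mul_assoc, o1, o2, o3, hx1p, k1, k2, kx2, mul_zero,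
      sub_zero, add_zero]
    simp only [pow_succ, pow_zero, one_mul, mul_assoc, c (j := y₂) e1,
      c (j := y₃) e1, c (j := y₂) e2, c (j := y₃) e2, c (i := x₂) (j := x₁) e2,
      hc (i := x₂) (j := x₁) e2]
    abel

/-- The Sullivan algebra `(Λ(x₁, x₂, y₁, y₂, y₃, z) ⊗ Λ(x_v, z_v | v ∈ V), d)` associated to a
finite simple graph. -/
noncomputable def sullivanAlgebra : CDGA.{u} :=
  FreeCGA.toCDGA G.sullivanDiff G.sullivanDiff_mem G.deriv_sullivanDiff

end SimpleGraph

/-! The algebra is probed by characters: `evalAt ξ s` sends `x₂` to `s`, each `x_v` to `ξ v`, and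
all other generators to `0`. The values of `d z_v` under these characters are cubics in which the
mixed terms `ξ v * ξ w * s ^ 4` record the edges.

Let `f` be an isomorphism. By degree, `f x₂ = r x₂` with `r ≠ 0`, and `f x_v` evaluates to a linear
form `∑ a v w ξ_w` plus `b v * s ^ 4`. Every coboundary of degree 120 evaluates to a combination of
the cubics and `s ^ 12` (`exists_evalAt_deriv`), because each `d y_i` is divisible by `x₁`. Hence `f
(d z_v) = d (f z_v)` becomes an identity of polynomial functions on the points (`exists_cubic_eq`).

At `s = 0` the cube of the linear form is a combination of the pure cubes `ξ_w ^ 3`, so at most one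
coefficient in each row of `a` is nonzero (`coeff_eq_zero`). Surjectivity of `f` forbids a zero
column (`exists_coeff_ne_zero`). Choosing a nonzero entry in each column gives an injection `τ : V'
→ V`; the same argument for the inverse of `f` equates the cardinalities, so `τ` is bijective.
Finally, the coefficients of `ξ_w ξ_u s ^ 4` on the two sides are nonzero exactly when `w, u`,
respectively `τ w, τ u`, are adjacent, so `τ` is a graph isomorphism. -/

namespace GraphGen

/-! ### Point evaluations and elements of low degree -/

variable {V : Type u}

theorem degree_pos (i : GraphGen V) : 0 < degree i := by
  cases i <;> simp [degree]

/-- Since all degrees are positive, nothing else fits beside `i`. This isolates the generators of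
degree 10, 40 and 119 among the monomials of their degree. -/
theorem eq_singleton_of_mem {l : List (GraphGen V)} {i : GraphGen V} (hi : i ∈ l)
    (hl : (l.map degree).sum ≤ degree i) : l = [i] := by
  obtain ⟨s, t, rfl⟩ := List.append_of_mem hi
  have nil_of_sum : ∀ r : List (GraphGen V), (r.map degree).sum = 0 → r = [] := by
    intro r hr
    cases r with
    | nil => rfl
    | cons j r =>
      have := degree_pos j
      simp only [List.map_cons, List.sum_cons] at hr
      omega
  simp only [List.map_append, List.map_cons, List.sum_append, List.sum_cons] at hl
  rw [nil_of_sum s (by omega), nil_of_sum t (by omega), List.nil_append]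

/-- The values on the generators of the point evaluation. -/
def value (ξ : V → ℚ) (s : ℚ) : GraphGen V → ℚ
  | x₂ => s
  | xv v => ξ v
  | _ => 0

/-- Makes the evaluation compatible with the sign rule: a sign can occur only between odd
generators, and these go to `0`. -/
theorem even_degree_or_value_eq_zero (ξ : V → ℚ) (s : ℚ) (i : GraphGen V) :
    Even (degree i) ∨ value ξ s i = 0 := by
  cases i with
  | x₂ => exact Or.inl (by simp only [degree]; decide)
  | xv => exact Or.inl (by simp only [degree]; decide)
  | _ => exact Or.inr rfl

/-- The evaluation of the algebra at the point with coordinates `x₂ = s` and `x_v = ξ v`, where all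
the other generators vanish. -/
noncomputable def evalAt (ξ : V → ℚ) (s : ℚ) : FreeCGA (degree (V := V)) →ₐ[ℚ] ℚ :=
  FreeCGA.lift (value ξ s) (by
    intro i j
    rcases even_degree_or_value_eq_zero ξ s i with hi | hi
    · rw [(hi.mul_right _).neg_one_pow, one_smul, mul_comm]
    · simp [hi])

@[simp] theorem evalAt_gen (ξ : V → ℚ) (s : ℚ) (i : GraphGen V) :
    evalAt ξ s (FreeCGA.gen _ i) = value ξ s i :=
  FreeCGA.lift_gen _ _ _

theorem evalAt_prod (ξ : V → ℚ) (s : ℚ) (l : List (GraphGen V)) :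
    evalAt ξ s (l.map (FreeCGA.gen _)).prod = (l.map (value ξ s)).prod := by
  rw [map_list_prod, List.map_map]
  congr 2
  funext i
  exact evalAt_gen ξ s i

theorem evalAt_eq_zero_of_lt (ξ : V → ℚ) {n : ℕ} (h0 : 0 < n) (hn : n < 40)
    {a : FreeCGA (degree (V := V))} (ha : a ∈ FreeCGA.homogeneous degree n) :
    evalAt ξ 0 a = 0 := by
  induction ha using Submodule.span_induction with
  | mem a h =>
    obtain ⟨l, rfl, rfl⟩ := h
    rw [evalAt_prod]
    cases l with
    | nil => simp at h0
    | cons i l =>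
      cases i <;> simp [value, degree] at hn ⊢
  | zero => exact map_zero _
  | add a b _ _ iha ihb => rw [map_add, iha, ihb, add_zero]
  | smul c a _ iha => rw [map_smul, iha, smul_zero]

theorem exists_smul_of_mem_ten {a : FreeCGA (degree (V := V))}
    (ha : a ∈ FreeCGA.homogeneous degree 10) : ∃ c : ℚ, a = c • FreeCGA.gen _ x₂ := by
  induction ha using Submodule.span_induction with
  | mem a h =>
    obtain ⟨l, hl, rfl⟩ := h
    by_cases hx : x₂ ∈ l
    · rw [eq_singleton_of_mem hx hl.le]
      exact ⟨1, by simp⟩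
    · exfalso
      -- Without `x₂` only `x₁` is small enough, and 8 does not divide 10.
      have h8 : ∀ k ∈ l.map degree, k = 8 := by
        intro k hk
        have hle := List.single_le_sum (fun _ _ => Nat.zero_le _) k hk
        obtain ⟨i, hi, rfl⟩ := List.mem_map.1 hk
        rw [hl] at hle
        cases i <;> simp_all [degree]
      rw [List.eq_replicate_of_mem h8] at hl
      simp only [List.sum_replicate, smul_eq_mul] at hl
      omega
  | zero => exact ⟨0, by simp⟩
  | add a b _ _ iha ihb =>
    obtain ⟨c, rfl⟩ := iha
    obtain ⟨e, rfl⟩ := ihb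
    exact ⟨c + e, by rw [add_smul]⟩
  | smul r a _ iha =>
    obtain ⟨c, rfl⟩ := iha
    exact ⟨r * c, by rw [mul_smul]⟩

/-- A monomial of degree 40 is a single `x_w`, or `x₂ ^ 4`, or contains a generator that evaluates
to `0`. -/
theorem exists_evalAt_of_mem_forty [Fintype V] {a : FreeCGA (degree (V := V))}
    (ha : a ∈ FreeCGA.homogeneous degree 40) :
    ∃ (c : V → ℚ) (b : ℚ), ∀ ξ s, evalAt ξ s a = ∑ w, c w * ξ w + b * s ^ 4 := by
  classical
  induction ha using Submodule.span_induction with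
  | mem a h =>
    obtain ⟨l, hl, rfl⟩ := h
    by_cases hx : ∃ w, xv w ∈ l
    · obtain ⟨w, hw⟩ := hx
      rw [eq_singleton_of_mem hw hl.le]
      exact ⟨Pi.single w 1, 0, fun ξ s => by simp [value, Pi.single_apply]⟩
    by_cases h2 : ∀ i ∈ l, i = x₂
    · rw [List.eq_replicate_of_mem h2] at hl ⊢
      simp only [List.map_replicate, List.sum_replicate, smul_eq_mul, degree] at hl
      have h4 : l.length = 4 := by omega
      exact ⟨0, 1, fun ξ s => by rw [evalAt_prod]; simp [value, h4]; ring⟩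
    · push Not at h2
      obtain ⟨i, hi, hne⟩ := h2
      refine ⟨0, 0, fun ξ s => ?_⟩
      rw [evalAt_prod, List.prod_eq_zero]
      · simp
      · refine List.mem_map.2 ⟨i, hi, ?_⟩
        cases i <;> first | rfl | exact absurd rfl hne | exact absurd ⟨_, hi⟩ hx
  | zero => exact ⟨0, 0, by simp⟩
  | add a a' _ _ iha iha' =>
    obtain ⟨c, b, h⟩ := iha
    obtain ⟨c', b', h'⟩ := iha'
    refine ⟨c + c', b + b', fun ξ s => ?_⟩
    simp only [map_add, h, h', Pi.add_apply, add_mul, Finset.sum_add_distrib]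
    ring
  | smul r a _ iha =>
    obtain ⟨c, b, h⟩ := iha
    refine ⟨r • c, r * b, fun ξ s => ?_⟩
    simp only [map_smul, h, Pi.smul_apply, smul_eq_mul, mul_add, Finset.mul_sum, mul_assoc]

end GraphGen

namespace SimpleGraph

open GraphGen

/-! ### Evaluating coboundaries -/

section Evaluation

variable {V : Type u} [Fintype V] (G : SimpleGraph V)

open Classical in
/-- The value of `d z_v` at the point `x₂ = s`, `x_w = ξ w`. -/
noncomputable def cubic (ξ : V → ℚ) (s : ℚ) (v : V) : ℚ :=
  ξ v ^ 3 + ∑ w : V with G.Adj v w, ξ v * ξ w * s ^ 4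

/-- The differentials of the generators involved are `0` or divisible by `x₁`, which evaluates to
`0`; the Leibniz rule extends this to products. -/
theorem evalAt_deriv_prod (ξ : V → ℚ) (s : ℚ) (l : List (GraphGen V))
    (hl : ∀ i ∈ l, GraphGen.degree i ≠ 119) :
    evalAt ξ s (FreeCGA.deriv G.sullivanDiff G.sullivanDiff_mem (l.map (FreeCGA.gen _)).prod) =
      0 := by
  induction l with
  | nil => simp [FreeCGA.deriv_one]
  | cons i l ih =>
    have hi : evalAt ξ s (G.sullivanDiff i) = 0 := by
      have := hl i (by simp)
      cases i <;> simp_all [sullivanDiff, value, GraphGen.degree]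
    rw [List.map_cons, List.prod_cons, FreeCGA.deriv_gen_mul, map_add, map_mul, hi, map_smul,
      map_mul, ih fun j hj => hl j (by simp [hj])]
    simp

/-- Only the monomials `z` and `z_v` contribute; in `d z` every term except `x₂ ^ 12` contains `x₁`.
-/
theorem exists_evalAt_deriv {a : FreeCGA (GraphGen.degree (V := V))}
    (ha : a ∈ FreeCGA.homogeneous GraphGen.degree 119) :
    ∃ (c : V → ℚ) (b : ℚ), ∀ ξ s,
      evalAt ξ s (FreeCGA.deriv G.sullivanDiff G.sullivanDiff_mem a) =
        ∑ w, c w * G.cubic ξ s w + b * s ^ 12 := by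
  classical
  induction ha using Submodule.span_induction with
  | mem a h =>
    obtain ⟨l, hl, rfl⟩ := h
    by_cases hx : ∀ i ∈ l, GraphGen.degree i ≠ 119
    · exact ⟨0, 0, fun ξ s => by simp [G.evalAt_deriv_prod ξ s l hx]⟩
    · push Not at hx
      obtain ⟨i, hi, hdeg⟩ := hx
      rw [eq_singleton_of_mem hi (hl.trans hdeg.symm).le]
      cases i with
      | z => exact ⟨0, 1, fun ξ s => by simp [sullivanDiff, value]⟩
      | zv v =>
        refine ⟨Pi.single v 1, 0, fun ξ s => ?_⟩
        simp only [List.map_cons, List.map_nil, List.prod_singleton, FreeCGA.deriv_gen]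
        simp [sullivanDiff, value, cubic, Pi.single_apply]
      | _ => simp [GraphGen.degree] at hdeg
  | zero => exact ⟨0, 0, by simp⟩
  | add a a' _ _ iha iha' =>
    obtain ⟨c, b, h⟩ := iha
    obtain ⟨c', b', h'⟩ := iha'
    refine ⟨c + c', b + b', fun ξ s => ?_⟩
    simp only [map_add, h, h', Pi.add_apply, add_mul, Finset.sum_add_distrib]
    ring
  | smul r a _ iha =>
    obtain ⟨c, b, h⟩ := iha
    refine ⟨r • c, r * b, fun ξ s => ?_⟩
    simp only [map_smul, h, Pi.smul_apply, smul_eq_mul, mul_add, Finset.mul_sum, mul_assoc]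

/-- The cubic at `t` is divisible by `ξ t`, so at a point supported on two vertices only these two
contribute. Such points suffice to detect one potential edge. -/
theorem sum_cubic_pair [DecidableEq V] (c : V → ℚ) {w u : V} (hwu : w ≠ u) (p q s : ℚ)
    [Decidable (G.Adj w u)] :
    ∑ t, c t * G.cubic (Pi.single w p + Pi.single u q) s t =
      c w * p ^ 3 + c u * q ^ 3 + if G.Adj w u then (c w + c u) * (p * q * s ^ 4) else 0 := by
  classical
  have hw : G.cubic (Pi.single w p + Pi.single u q) s w =
      p ^ 3 + if G.Adj w u then p * q * s ^ 4 else 0 := by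
    rw [cubic, Finset.sum_filter, Finset.sum_eq_single u]
    · simp [hwu, hwu.symm]
    · intro t _ htu
      by_cases htw : t = w <;> simp_all
    · simp
  have hu : G.cubic (Pi.single w p + Pi.single u q) s u =
      q ^ 3 + if G.Adj w u then p * q * s ^ 4 else 0 := by
    rw [cubic, Finset.sum_filter, Finset.sum_eq_single w]
    · simp [hwu, hwu.symm, G.adj_comm u w, mul_comm]
    · intro t _ htw
      by_cases htu : t = u <;> simp_all
    · simp
  rw [Finset.sum_eq_add w u hwu, hw, hu]
  · split_ifs <;> ring
  · intro t _ ht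
    simp [cubic, ht.1, ht.2]
  · simp
  · simp

end Evaluation

/-! ### The matrix of an isomorphism on the generators `x_v` -/

section Isomorphism

variable {V : Type u} {V' : Type v} [Fintype V] [Fintype V'] {G₁ : SimpleGraph V}
  {G₂ : SimpleGraph V'}

/-- An isomorphism of the Sullivan algebras, as an isomorphism of the underlying algebras. -/
noncomputable def isoAlgEquiv (f : CDGA.Iso G₁.sullivanAlgebra G₂.sullivanAlgebra) :
    FreeCGA (GraphGen.degree (V := V)) ≃ₐ[ℚ] FreeCGA (GraphGen.degree (V := V')) :=
  f.toAlgEquiv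

variable (f : CDGA.Iso G₁.sullivanAlgebra G₂.sullivanAlgebra)

theorem isoAlgEquiv_mem {n : ℕ} {a : FreeCGA (GraphGen.degree (V := V))}
    (ha : a ∈ FreeCGA.homogeneous GraphGen.degree n) :
    isoAlgEquiv f a ∈ FreeCGA.homogeneous GraphGen.degree n :=
  (f.mem_grading_iff n a).2 ha

theorem isoAlgEquiv_symm_mem {n : ℕ} {a : FreeCGA (GraphGen.degree (V := V'))}
    (ha : a ∈ FreeCGA.homogeneous GraphGen.degree n) :
    (isoAlgEquiv f).symm a ∈ FreeCGA.homogeneous GraphGen.degree n := by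
  refine (f.mem_grading_iff n ((isoAlgEquiv f).symm a)).1 ?_
  change isoAlgEquiv f ((isoAlgEquiv f).symm a) ∈ FreeCGA.homogeneous GraphGen.degree n
  rwa [AlgEquiv.apply_symm_apply]

theorem isoAlgEquiv_deriv (a : FreeCGA (GraphGen.degree (V := V))) :
    isoAlgEquiv f (FreeCGA.deriv G₁.sullivanDiff G₁.sullivanDiff_mem a) =
      FreeCGA.deriv G₂.sullivanDiff G₂.sullivanDiff_mem (isoAlgEquiv f a) :=
  f.map_d a

/-- The coefficients of the generators `x_w` in the image of `x_v`. -/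
theorem exists_coeff :
    ∃ (a : V → V' → ℚ) (b : V → ℚ), ∀ v ξ s,
      evalAt ξ s (isoAlgEquiv f (FreeCGA.gen _ (xv v))) = ∑ w, a v w * ξ w + b v * s ^ 4 := by
  choose a b h using fun v => exists_evalAt_of_mem_forty
    (isoAlgEquiv_mem f (FreeCGA.gen_mem (deg := GraphGen.degree) (xv v)))
  exact ⟨a, b, h⟩

theorem exists_scale : ∃ r : ℚ, r ≠ 0 ∧
    ∀ ξ s, evalAt ξ s (isoAlgEquiv f (FreeCGA.gen _ x₂)) = r * s := by
  obtain ⟨r, hr⟩ := exists_smul_of_mem_ten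
    (isoAlgEquiv_mem f (FreeCGA.gen_mem (deg := GraphGen.degree) x₂))
  refine ⟨r, ?_, fun ξ s => by simp [hr, value]⟩
  rintro rfl
  rw [zero_smul, EmbeddingLike.map_eq_zero_iff] at hr
  have h := congrArg (evalAt (0 : V → ℚ) 1) hr
  simp [value] at h

-- Evaluates `d (f z_v) = f (d z_v)`: the left side through `exists_evalAt_deriv`, the right side
-- through multiplicativity.
open Classical in
theorem exists_cubic_eq {a : V → V' → ℚ} {b : V → ℚ} {r : ℚ}
    (hab : ∀ v ξ s,
      evalAt ξ s (isoAlgEquiv f (FreeCGA.gen _ (xv v))) = ∑ w, a v w * ξ w + b v * s ^ 4)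
    (hr : ∀ ξ s, evalAt ξ s (isoAlgEquiv f (FreeCGA.gen _ x₂)) = r * s) (v : V) :
    ∃ (c : V' → ℚ) (k : ℚ), ∀ ξ s,
      ∑ w, c w * G₂.cubic ξ s w + k * s ^ 12 =
        (∑ w, a v w * ξ w + b v * s ^ 4) ^ 3 +
          ∑ v' : V with G₁.Adj v v', (∑ w, a v w * ξ w + b v * s ^ 4) *
            (∑ w, a v' w * ξ w + b v' * s ^ 4) * (r * s) ^ 4 := by
  obtain ⟨c, k, h⟩ := G₂.exists_evalAt_deriv
    (isoAlgEquiv_mem f (FreeCGA.gen_mem (deg := GraphGen.degree) (zv v)))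
  refine ⟨c, k, fun ξ s => ?_⟩
  rw [← h, ← isoAlgEquiv_deriv, FreeCGA.deriv_gen]
  simp only [sullivanDiff, map_add, map_sum, map_mul, map_pow, hab, hr]

theorem coeff_eq_zero {a : V → V' → ℚ} {b : V → ℚ}
    (hab : ∀ v ξ s,
      evalAt ξ s (isoAlgEquiv f (FreeCGA.gen _ (xv v))) = ∑ w, a v w * ξ w + b v * s ^ 4)
    {v : V} {w u : V'} (hwu : w ≠ u) (hw : a v w ≠ 0) : a v u = 0 := by
  classical
  obtain ⟨r, -, hr⟩ := exists_scale f
  obtain ⟨c, k, h⟩ := exists_cubic_eq f hab hr v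
  -- Taking `s = 0` removes the edge terms and the contributions of `b` and `k`.
  have key : ∀ p q : ℚ, c w * p ^ 3 + c u * q ^ 3 = (a v w * p + a v u * q) ^ 3 := by
    intro p q
    have := h (Pi.single w p + Pi.single u q) 0
    rw [G₂.sum_cubic_pair c hwu] at this
    simpa [mul_add, Finset.sum_add_distrib, Pi.single_apply] using this
  have h1 := key 1 0
  have h2 := key 0 1
  have h3 := key 1 1
  have h4 := key 1 (-1)
  -- The values at `(1, 1)` and `(1, -1)` separate the two mixed terms of the binomial cube.
  have : a v w * a v u ^ 2 = 0 := by linarith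
  simpa [hw] using this

/-- If column `w` vanished, evaluation at the basis point of `w` with `s = 0` would kill the image
of all of degree 40. But that image contains `x_w`, whose value there is 1. -/
theorem exists_coeff_ne_zero {a : V → V' → ℚ} {b : V → ℚ}
    (hab : ∀ v ξ s,
      evalAt ξ s (isoAlgEquiv f (FreeCGA.gen _ (xv v))) = ∑ w, a v w * ξ w + b v * s ^ 4)
    (w : V') : ∃ v, a v w ≠ 0 := by
  classical
  by_contra! hall
  have key : ∀ m ∈ FreeCGA.homogeneous (GraphGen.degree (V := V)) 40,
      evalAt (Pi.single w 1) 0 (isoAlgEquiv f m) = 0 := by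
    intro m hm
    induction hm using Submodule.span_induction with
    | mem m h =>
      obtain ⟨l, hl, rfl⟩ := h
      by_cases hx : ∃ v, xv v ∈ l
      · obtain ⟨v, hv⟩ := hx
        rw [eq_singleton_of_mem hv hl.le]
        simp [hab, Pi.single_apply, hall]
      · cases l with
        | nil => simp at hl
        | cons i l =>
          -- A monomial without any `x_v` starts with a generator of degree below 40; its image
          -- keeps that degree, hence vanishes at `s = 0`.
          have hi : GraphGen.degree i < 40 := by
            simp only [List.map_cons, List.sum_cons] at hl
            cases i <;> simp [GraphGen.degree] at hl hx ⊢ <;> omega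
          rw [List.map_cons, List.prod_cons, map_mul, map_mul,
            evalAt_eq_zero_of_lt _ (GraphGen.degree_pos i) hi (isoAlgEquiv_mem f (FreeCGA.gen_mem i)),
            zero_mul]
    | zero => simp
    | add m m' _ _ ih ih' => rw [map_add, map_add, ih, ih', add_zero]
    | smul t m _ ih => rw [map_smul, map_smul, ih, smul_zero]
  have h := key _ (isoAlgEquiv_symm_mem f (FreeCGA.gen_mem (deg := GraphGen.degree) (xv w)))
  simp [value] at h

theorem exists_injective {a : V → V' → ℚ} {b : V → ℚ}
    (hab : ∀ v ξ s,
      evalAt ξ s (isoAlgEquiv f (FreeCGA.gen _ (xv v))) = ∑ w, a v w * ξ w + b v * s ^ 4) :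
    ∃ τ : V' → V, Function.Injective τ ∧ ∀ w, a (τ w) w ≠ 0 := by
  choose τ hτ using exists_coeff_ne_zero f hab
  refine ⟨τ, fun w u h => ?_, hτ⟩
  by_contra hwu
  exact hτ u (h ▸ coeff_eq_zero f hab hwu (hτ w))

end Isomorphism

end SimpleGraph

/-- The inverse of an isomorphism of commutative differential graded algebras. -/
def CDGA.Iso.symm {A : CDGA.{u}} {B : CDGA.{v}} (f : CDGA.Iso A B) : CDGA.Iso B A where
  toAlgEquiv := f.toAlgEquiv.symm
  mem_grading_iff n b := by
    rw [← f.mem_grading_iff, AlgEquiv.apply_symm_apply]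
  map_d b := by
    rw [AlgEquiv.symm_apply_eq, f.map_d, AlgEquiv.apply_symm_apply]

/-! ### Recovering the graph -/

namespace SimpleGraph

open GraphGen

theorem nonempty_iso_of_sullivanAlgebra_iso {V : Type u} {V' : Type v} [Fintype V] [Fintype V']
    {G₁ : SimpleGraph V} {G₂ : SimpleGraph V'}
    (f : CDGA.Iso G₁.sullivanAlgebra G₂.sullivanAlgebra) : Nonempty (G₁ ≃g G₂) := by
  classical
  obtain ⟨a, b, hab⟩ := exists_coeff f
  obtain ⟨r, hr0, hr⟩ := exists_scale f
  obtain ⟨τ, hτ, hne⟩ := exists_injective f hab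
  obtain ⟨_, _, hab'⟩ := exists_coeff f.symm
  obtain ⟨τ', hτ', -⟩ := exists_injective f.symm hab'
  -- The injection from the inverse isomorphism serves only to compare cardinalities.
  have hcard : Fintype.card V' = Fintype.card V :=
    le_antisymm (Fintype.card_le_of_injective τ hτ) (Fintype.card_le_of_injective τ' hτ')
  have hbij : Function.Bijective τ := (Fintype.bijective_iff_injective_and_card τ).2 ⟨hτ, hcard⟩
  have hsum : ∀ w (ξ : V' → ℚ), ∑ t, a (τ w) t * ξ t = a (τ w) w * ξ w := by
    intro w ξ
    refine Finset.sum_eq_single w (fun t _ ht => ?_) (by simp)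
    rw [coeff_eq_zero f hab ht.symm (hne w), zero_mul]
  have hadj : ∀ w u, G₁.Adj (τ w) (τ u) ↔ G₂.Adj w u := by
    intro w u
    by_cases hwu : w = u
    · simp [hwu]
    obtain ⟨c, k, h⟩ := exists_cubic_eq f hab hr (τ w)
    simp only [Finset.sum_filter, ← hbij.sum_comp (fun v' => if G₁.Adj (τ w) v' then _ else (0 : ℚ)),
      hsum] at h
    -- `K` gathers the `x₂ ^ 4` parts of the images of the neighbours of `τ w`.
    set K : ℚ := ∑ t, if G₁.Adj (τ w) (τ t) then b (τ t) else 0 with hK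
    have key : ∀ p q s : ℚ,
        c w * p ^ 3 + c u * q ^ 3 + (if G₂.Adj w u then (c w + c u) * (p * q * s ^ 4) else 0) +
            k * s ^ 12 =
          (a (τ w) w * p + b (τ w) * s ^ 4) ^ 3 +
            (a (τ w) w * p + b (τ w) * s ^ 4) *
              ((if G₁.Adj (τ w) (τ u) then a (τ u) u * q else 0) + K * s ^ 4) * (r * s) ^ 4 := by
      intro p q s
      have hs : (∑ t, if G₁.Adj (τ w) (τ t) then (a (τ w) w * p + b (τ w) * s ^ 4) *
            (a (τ t) t * (Pi.single w p + Pi.single u q : V' → ℚ) t + b (τ t) * s ^ 4) *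
              (r * s) ^ 4 else 0) =
          (a (τ w) w * p + b (τ w) * s ^ 4) *
            ((if G₁.Adj (τ w) (τ u) then a (τ u) u * q else 0) + K * s ^ 4) * (r * s) ^ 4 := by
        have hu : (if G₁.Adj (τ w) (τ u) then a (τ u) u * q else 0) =
            ∑ t, if G₁.Adj (τ w) (τ t) then
              a (τ t) t * (Pi.single w p + Pi.single u q : V' → ℚ) t else 0 := by
          rw [Finset.sum_eq_single u]
          · simp [Ne.symm hwu]
          · intro t _ ht
            by_cases htw : t = w <;> simp_all
          · simp
        rw [hu, hK, Finset.sum_mul, ← Finset.sum_add_distrib, Finset.mul_sum, Finset.sum_mul]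
        refine Finset.sum_congr rfl fun t _ => ?_
        split_ifs <;> ring
      have := h (Pi.single w p + Pi.single u q) s
      rw [G₂.sum_cubic_pair c hwu] at this
      rw [← hs]
      simpa [hwu] using this
    have hcw : c w = a (τ w) w ^ 3 := by simpa [mul_pow] using key 1 0 0
    have hcu : c u = 0 := by simpa using key 0 1 0
    have h00 := key 0 0 1
    have h01 := key 0 1 1
    have h10 := key 1 0 1
    have h11 := key 1 1 1
    have hw0 := hne w
    -- The alternating sum of the values at `p, q ∈ {0, 1}`, `s = 1`, isolates the `p * q` term, so
    -- `b`, `K` and `k` drop out. On the left `c w + c u` is `a (τ w) w ^ 3`.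
    have hmain : (if G₂.Adj w u then a (τ w) w ^ 3 else 0) =
        if G₁.Adj (τ w) (τ u) then a (τ w) w * a (τ u) u * r ^ 4 else 0 := by
      rw [hcu, hcw] at h00 h01 h10 h11
      split_ifs at h00 h01 h10 h11 ⊢ <;> linarith
    split_ifs at hmain with h2 h1 h1
    · exact iff_of_true h1 h2
    · exact absurd hmain (pow_ne_zero _ hw0)
    · exact absurd hmain.symm (mul_ne_zero (mul_ne_zero hw0 (hne u)) (pow_ne_zero _ hr0))
    · exact iff_of_false h1 h2
  exact ⟨RelIso.symm ⟨Equiv.ofBijective τ hbij, fun {w u} => hadj w u⟩⟩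

end SimpleGraph

theorem mainTheorem6 {V : Type u} {V' : Type v} [Fintype V] [Fintype V']
    (G₁ : SimpleGraph V) (G₂ : SimpleGraph V') (h : IsEmpty (G₁ ≃g G₂)) :
    IsEmpty (CDGA.Iso G₁.sullivanAlgebra G₂.sullivanAlgebra) :=
  ⟨fun f => h.elim' (SimpleGraph.nonempty_iso_of_sullivanAlgebra_iso f).some⟩
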